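/- Suppose $m$ drivers arrive one after the other at a linear car park with $n$ spaces numbered $1,\dots,n$. Each driver has a preferred space, drives to it and parks there if it is free, and otherwise takes the first free space with a larger number; if there is none, the driver leaves (fails to park). The *defect* of an assignment $f:\{1,\dots,m\}\to\{1,\dots,n\}$ of preferred spaces is the number of drivers who fail to park. In a random assignment, $f$ is uniformly distributed over the $n^m$ possibilities. For $n,m,k\in\mathbb N_0$ let $$S(n,m,k)=\begin{cases} n^m & \text{if } k\le m-n,\\ \displaystyle\sum_{i=0}^{m-k}\binom mi (n-m+k)(n-m+k+i)^{i-1}(m-k-i)^{m-i} & \text{otherwise,}\end{cases}$$ where the sum is empty if $k>m$ and $0^0=1$. **Theorem.** Let $x>0$ and $y$ be real numbers, and for $n\in\mathbb N$ put $m=n+\lfloor y\sqrt n\rfloor$ (which is nonnegative for all large $n$) and $k=\lfloor x\sqrt n\rfloor$. Then the probability that in a random assignment of $m$ drivers to $n$ spaces at least $k$ drivers fail to park satisfies $$\lim_{n\to\infty}\Pr[\text{at least } k \text{ drivers fail to park}]=\begin{cases} e^{-2x(x-y)} & \text{if } x>y,\\ 1 & \text{otherwise,}\end{cases}$$ and $\displaystyle\lim_{n\to\infty}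 S(n,m,k)/n^m$ exists and has the same value. In particular, for $m=n$, let $D_n$ be the defect of a random assignment of $n$ drivers to $n$ spaces. Then $D_n/\sqrt n$ converges in distribution, as $n\to\infty$, to the Rayleigh distribution with parameter $1/2$, that is, to the probability measure on $(0,\infty)$ with density $4t\,e^{-2t^2}$. -/

import Mathlib

open MeasureTheory ProbabilityTheory Filter Topology

/-- The free spaces numbered `p` or larger, when the spaces in `occ` are occupied. -/
def freeFrom {n : ℕ} (occ : Finset (Fin n)) (p : Fin n) : Finset (Fin n) :=
  Finset.univ.filter (fun s => p ≤ s ∧ s ∉ occ)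

/-- Drivers with the given list of preferred spaces arrive one after the other at a linear car park
in which the spaces in `occ` are already occupied. Each of them takes the first free space from the
preferred one onwards, and leaves if there is none. The value is the number of those who leave. -/
def failures {n : ℕ} (occ : Finset (Fin n)) : List (Fin n) → ℕ
  | [] => 0
  | p :: ps =>
    if h : (freeFrom occ p).Nonempty then
      failures (insert ((freeFrom occ p).min' h) occ) ps
    else
      failures occ ps + 1

/-- The defect of an assignment `f` of preferred spaces to `m` drivers: the number of drivers who
fail to park when they arrive in the order `0, 1, …, m - 1` at an empty car park with `n` spaces. -/
def defect {m n : ℕ} (f : Fin m → Fin n) : ℕ :=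
  failures ∅ (List.ofFn f)

/-- The law of a uniformly random assignment of `m` drivers to `n` spaces. -/
noncomputable def assignmentMeasure (m n : ℕ) : Measure (Fin m → Fin n) :=
  uniformOn Set.univ

instance assignmentMeasure_isProbabilityMeasure (n : ℕ) :
    IsProbabilityMeasure (assignmentMeasure n n) :=
  isProbabilityMeasure_uniformOn Set.finite_univ ⟨id, trivial⟩

/-- The sum `S(n, m, k)`. It is `n ^ m` if `k ≤ m - n`; otherwise it is the sum over
`0 ≤ i ≤ m - k` (an empty sum if `k > m`), in which `n - m + k ≥ 1`. -/
noncomputable def abelSum (n m k : ℕ) : ℝ :=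
  if n + k ≤ m then (n : ℝ) ^ m
  else ∑ i ∈ Finset.range (m + 1 - k),
    (m.choose i : ℝ) * ((n : ℝ) - m + k) * ((n : ℝ) - m + k + i) ^ ((i : ℤ) - 1) *
      ((m : ℝ) - k - i) ^ (m - i)

/-- The number of drivers `n + ⌊y √n⌋`. This integer is nonnegative for all large `n`; the finitely
many negative values are replaced by `0`. -/
noncomputable def numDrivers (y : ℝ) (n : ℕ) : ℕ :=
  ((n : ℤ) + ⌊y * √(n : ℝ)⌋).toNat

/-- The Rayleigh distribution with parameter `σ`: density `t / σ² · exp (-t² / (2σ²))` on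
`(0, ∞)`. -/
noncomputable def rayleighMeasure (σ : ℝ) : Measure ℝ :=
  (volume.restrict (Set.Ioi 0)).withDensity
    (fun t => ENNReal.ofReal (t / σ ^ 2 * Real.exp (-t ^ 2 / (2 * σ ^ 2))))

theorem isProbabilityMeasure_rayleighMeasure {σ : ℝ} (hσ : 0 < σ) :
    IsProbabilityMeasure (rayleighMeasure σ) := by
  have hd : ∀ t ∈ Set.Ici (0 : ℝ), HasDerivAt (fun t : ℝ => -Real.exp (-t ^ 2 / (2 * σ ^ 2)))
      (t / σ ^ 2 * Real.exp (-t ^ 2 / (2 * σ ^ 2))) t := by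
    intro t _
    have h1 : HasDerivAt (fun t : ℝ => -t ^ 2 / (2 * σ ^ 2)) (-(2 * t) / (2 * σ ^ 2)) t := by
      simpa using ((hasDerivAt_pow 2 t).neg.div_const (2 * σ ^ 2))
    refine h1.exp.neg.congr_deriv ?_
    rw [neg_div (2 * σ ^ 2) (2 * t), mul_div_mul_left t (σ ^ 2) (two_ne_zero (α := ℝ))]
    ring
  have hpos : ∀ t ∈ Set.Ioi (0 : ℝ), 0 ≤ t / σ ^ 2 * Real.exp (-t ^ 2 / (2 * σ ^ 2)) := by
    intro t ht
    have : 0 < t := ht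
    positivity
  have hlim : Tendsto (fun t : ℝ => -Real.exp (-t ^ 2 / (2 * σ ^ 2))) atTop (𝓝 0) := by
    rw [← neg_zero]
    refine Tendsto.neg (Real.tendsto_exp_atBot.comp ?_)
    refine Tendsto.atBot_div_const (by positivity) ?_
    exact tendsto_neg_atTop_atBot.comp (tendsto_pow_atTop two_ne_zero)
  have hint := integrableOn_Ioi_deriv_of_nonneg' hd hpos hlim
  have hval := integral_Ioi_of_hasDerivAt_of_nonneg' hd hpos hlim
  constructor
  rw [rayleighMeasure, withDensity_apply _ MeasurableSet.univ, Measure.restrict_univ,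
    ← ofReal_integral_eq_lintegral_ofReal hint
      ((ae_restrict_iff' measurableSet_Ioi).2 (Eventually.of_forall hpos)), hval]
  simp

instance isProbabilityMeasure_rayleighMeasure_half :
    IsProbabilityMeasure (rayleighMeasure (1 / 2)) :=
  isProbabilityMeasure_rayleighMeasure (by norm_num)

/-! At least `k` drivers fail exactly when, for some `s`, the spaces from `s` on are preferred by at
least `k` more drivers than there are such spaces. With `a = n - m + k > 0`, this says that the walk
`s - numBelow f s` reaches `a`. The walk climbs by at most one per step, so it hits `a` exactly.
Splitting the assignments by the set `I` of drivers counted at the first hit gives `abelSum n m k`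
(`card_filter_le_defect`). The number of first passages for the drivers in `I` comes from Abel's
identity by induction.

For the limit, put `r = m - k`, so that `n = a + r`. Abel's identity makes the numbers `q i = C(r,i)
a (a+i)^(i-1) (r-i)^(r-i) / n^r` a probability distribution, and `abelSum n m k / n^m` is `(m)_k /
n^k` times the `q`-mean of `g (r - i)`, where `g N = N^k / ((N+1)⋯(N+k))`. Replace `g N` by `h N =
(N)_k / N^k`: the two differ by at most `2/√k` uniformly in `N`
(`abs_descFactorial_div_sub_div_ascFactorial_le`), and a second use of Abel's identity evaluates the
mean of `h` exactly as `(r)_k / n^k`. Thus the probability is `(m)_{2k} / n^{2k}` up to a vanishing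
error (`abs_abelSum_div_sub_le`), and a logarithm gives the limit `exp (2xy - 2x²)`.

The Rayleigh law has the tail `exp (-2t²)`, which is the case `y = 0`. -/

/-! ### Abel's identity -/

/-- **Abel's binomial identity.** -/
theorem abel_identity {a : ℝ} (ha : 0 < a) (M : ℕ) (c : ℝ) :
    ∑ i ∈ Finset.range (M + 1), (M.choose i : ℝ) * a * (a + i) ^ ((i : ℤ) - 1) *
      (c + ((M - i : ℕ) : ℝ)) ^ (M - i) = (a + c + M) ^ M := by
  induction M generalizing c with
  | zero => simp [ha.ne']
  | succ M ih =>
    set w : ℕ → ℝ := fun i => a * (a + i) ^ ((i : ℤ) - 1) with hw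
    set F : ℝ → ℝ := fun c => ∑ i ∈ Finset.range (M + 1 + 1), ((M + 1).choose i : ℝ) * w i *
      (c + ((M + 1 - i : ℕ) : ℝ)) ^ (M + 1 - i) with hF
    -- Differentiating in `c` turns each side into `M + 1` times the identity for `M` at `c + 1`, so
    -- the two sides differ by a constant.
    have hderiv : ∀ c, HasDerivAt (fun c => F c - (a + c + (M + 1 : ℕ)) ^ (M + 1)) 0 c := by
      intro c
      have h1 : HasDerivAt F (∑ i ∈ Finset.range (M + 1 + 1), ((M + 1).choose i : ℝ) * w i *
          (((M + 1 - i : ℕ) : ℝ) * (c + ((M + 1 - i : ℕ) : ℝ)) ^ (M + 1 - i - 1))) c := by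
        refine HasDerivAt.fun_sum fun i _ => ?_
        simpa using (((hasDerivAt_id c).add_const ((M + 1 - i : ℕ) : ℝ)).pow
          (M + 1 - i)).const_mul (((M + 1).choose i : ℝ) * w i)
      have h2 : HasDerivAt (fun c : ℝ => (a + c + (M + 1 : ℕ)) ^ (M + 1))
          ((M + 1 : ℕ) * (a + c + (M + 1 : ℕ)) ^ M) c := by
        simpa using (((hasDerivAt_id c).const_add a).add_const ((M + 1 : ℕ) : ℝ)).fun_pow (M + 1)
      refine (h1.sub h2).congr_deriv ?_
      rw [Finset.sum_range_succ, sub_eq_zero]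
      simp only [Nat.sub_self, Nat.cast_zero, zero_mul, mul_zero, add_zero]
      have := ih (c + 1)
      rw [show a + c + ((M + 1 : ℕ) : ℝ) = a + (c + 1) + M by push_cast; ring, ← this,
        Finset.mul_sum]
      refine Finset.sum_congr rfl fun i hi => ?_
      have hi' : i ≤ M := by simpa [Nat.lt_succ_iff] using hi
      have e1 : M + 1 - i = M - i + 1 := by omega
      have e2 : ((M + 1).choose i : ℝ) * ((M - i + 1 : ℕ) : ℝ) = (M + 1 : ℕ) * M.choose i := by
        have := Nat.choose_mul_succ_eq M i
        rw [e1] at this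
        rw [← Nat.cast_mul, ← Nat.cast_mul, ← this, Nat.mul_comm]
      rw [e1, Nat.add_sub_cancel]
      calc _ = (((M + 1).choose i : ℝ) * ((M - i + 1 : ℕ) : ℝ)) * w i *
            (c + ((M - i + 1 : ℕ) : ℝ)) ^ (M - i) := by ring
        _ = _ := by rw [e2, hw]; push_cast; ring
    have hconst := is_const_of_deriv_eq_zero (fun c => (hderiv c).differentiableAt)
      (fun c => (hderiv c).deriv)
    -- The constant is found where the right side vanishes. There the powers of `a + i` combine to
    -- `± (a + i) ^ M`, and the sum is an `(M + 1)`-st difference of a polynomial of degree `M`.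
    have hzero : F (-a - (M + 1 : ℕ)) = 0 := by
      have hd := congrFun (fwdDiff_iter_pow_eq_zero_of_lt (R := ℝ) (Nat.lt_succ_self M)) a
      rw [fwdDiff_iter_eq_sum_shift] at hd
      calc F (-a - (M + 1 : ℕ)) = a * ∑ k ∈ Finset.range (M + 1 + 1),
            ((-1 : ℤ) ^ (M + 1 - k) * ((M + 1).choose k : ℤ)) • (a + k • (1 : ℝ)) ^ M := by
            rw [hF, Finset.mul_sum]
            refine Finset.sum_congr rfl fun i hi => ?_
            have hi' : i ≤ M + 1 := by simpa [Nat.lt_succ_iff] using hi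
            have hne : a + i ≠ 0 := by positivity
            have e : -a - ((M + 1 : ℕ) : ℝ) + ((M + 1 - i : ℕ) : ℝ) = (-1) * (a + i) := by
              rw [Nat.cast_sub hi']; ring
            have e3 : (a + (i : ℝ)) ^ ((i : ℤ) - 1) * (a + i) ^ (M + 1 - i) = (a + i) ^ M := by
              rw [← zpow_natCast, ← zpow_add₀ hne, ← zpow_natCast]
              congr 1
              omega
            rw [e, mul_pow, zsmul_eq_mul, hw]
            simp only [nsmul_eq_mul, mul_one]
            rw [← e3]
            push_cast
            ring
        _ = 0 := by simpa using Or.inr hd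
    have := hconst c (-a - (M + 1 : ℕ))
    simp only [hzero] at this
    rw [show a + (-a - ((M + 1 : ℕ) : ℝ)) + ((M + 1 : ℕ) : ℝ) = 0 by ring,
      zero_pow (Nat.succ_ne_zero M), sub_zero, sub_eq_zero] at this
    rw [← this, hF]
    refine Finset.sum_congr rfl fun i _ => ?_
    rw [hw]; ring

/-! ### Failures and overloaded final segments -/

/-- The number of free spaces numbered `s` or larger. -/
def numFree {n : ℕ} (occ : Finset (Fin n)) (s : ℕ) : ℕ :=
  (Finset.univ.filter (fun t : Fin n => s ≤ t ∧ t ∉ occ)).card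

theorem numFree_top {n : ℕ} (occ : Finset (Fin n)) : numFree occ n = 0 := by
  rw [numFree, Finset.card_eq_zero, Finset.filter_eq_empty_iff]
  rintro t - ⟨h, -⟩
  exact absurd t.2 (not_lt.2 h)

theorem numFree_insert_of_lt {n : ℕ} {occ : Finset (Fin n)} {q : Fin n} {s : ℕ} (h : (q : ℕ) < s) :
    numFree (insert q occ) s = numFree occ s := by
  unfold numFree
  congr 1
  refine Finset.filter_congr fun t _ => ?_
  rw [Finset.mem_insert]
  constructor
  · rintro ⟨h1, h2⟩
    exact ⟨h1, fun h3 => h2 (Or.inr h3)⟩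
  · rintro ⟨h1, h2⟩
    refine ⟨h1, ?_⟩
    rintro (rfl | h3)
    · omega
    · exact h2 h3

theorem numFree_insert_of_le {n : ℕ} {occ : Finset (Fin n)} {q : Fin n} {s : ℕ} (h : s ≤ q)
    (hq : q ∉ occ) : numFree occ s = numFree (insert q occ) s + 1 := by
  unfold numFree
  rw [← Finset.card_insert_of_notMem (a := q)]
  · congr 1
    ext t
    simp only [Finset.mem_filter, Finset.mem_univ, true_and, Finset.mem_insert]
    by_cases ht : t = q
    · subst ht; simp [h, hq]
    · simp [ht]
  · simp

theorem numFree_congr {n : ℕ} {occ : Finset (Fin n)} {p s : ℕ} (hps : p ≤ s)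
    (h : ∀ t : Fin n, p ≤ t → t ∉ occ → s ≤ t) : numFree occ p = numFree occ s := by
  unfold numFree
  congr 1
  refine Finset.filter_congr fun t _ => ?_
  exact ⟨fun ⟨h1, h2⟩ => ⟨h t h1 h2, h2⟩, fun ⟨h1, h2⟩ => ⟨hps.trans h1, h2⟩⟩

theorem countP_le_countP_of_le {n : ℕ} (ps : List (Fin n)) {p s : ℕ} (h : p ≤ s) :
    ps.countP (fun t : Fin n => s ≤ (t : ℕ)) ≤ ps.countP (fun t : Fin n => p ≤ (t : ℕ)) := by
  refine List.countP_mono_left fun t _ ht => ?_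
  simp only [decide_eq_true_eq] at ht ⊢
  omega

/-- At least `k` drivers fail to park if and only if some final segment of the car park is preferred
by at least `k` more drivers than it has free spaces. -/
theorem le_failures_iff {n : ℕ} (ps : List (Fin n)) (occ : Finset (Fin n)) (k : ℕ) :
    k ≤ failures occ ps ↔
      ∃ s ≤ n, numFree occ s + k ≤ ps.countP (fun t : Fin n => s ≤ (t : ℕ)) := by
  induction ps generalizing occ k with
  | nil =>
    simp only [failures, List.countP_nil]
    constructor
    · intro h
      exact ⟨n, le_rfl, by rw [numFree_top]; omega⟩
    · rintro ⟨s, -, h⟩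
      omega
  | cons p ps ih =>
    have hcons : ∀ s : ℕ, (p :: ps).countP (fun t : Fin n => s ≤ (t : ℕ)) =
        ps.countP (fun t : Fin n => s ≤ (t : ℕ)) + if s ≤ (p : ℕ) then 1 else 0 := by
      intro s
      rw [List.countP_cons]
      simp
    simp only [hcons]
    rw [failures]
    split_ifs with h
    · set q := (freeFrom occ p).min' h with hq
      have hqm : p ≤ q ∧ q ∉ occ := by
        have := Finset.min'_mem _ h
        rw [← hq] at this
        simpa [freeFrom] using this
      have hmin : ∀ t : Fin n, p ≤ t → t ∉ occ → q ≤ t := fun t h1 h2 =>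
        Finset.min'_le _ _ (by simp [freeFrom, h1, h2])
      have hpq : (p : ℕ) ≤ q := hqm.1
      rw [ih]
      constructor
      · rintro ⟨s, hs, hle⟩
        rcases lt_or_ge (q : ℕ) s with hsq | hsq
        · exact ⟨s, hs, by rw [numFree_insert_of_lt hsq] at hle; omega⟩
        have h1 := numFree_insert_of_le hsq hqm.2
        rcases le_or_gt s p with hsp | hsp
        · exact ⟨s, hs, by rw [if_pos hsp]; omega⟩
        -- For `p < s ≤ q` the new driver is not counted in the segment from `s`, yet takes a space
        -- of it. No space from `p` up to `q` is free, so the segment can be started at `p` without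
        -- gaining free spaces.
        · refine ⟨p, p.2.le, ?_⟩
          have h2 := numFree_congr hsp.le (occ := occ) fun t h3 h4 => hsq.trans (hmin t h3 h4)
          have h3 := countP_le_countP_of_le ps hsp.le
          rw [if_pos le_rfl]
          omega
      · rintro ⟨s, hs, hle⟩
        refine ⟨s, hs, ?_⟩
        rcases lt_or_ge (q : ℕ) s with hsq | hsq
        · rw [numFree_insert_of_lt hsq]
          rw [if_neg (by omega)] at hle
          omega
        · have h1 := numFree_insert_of_le hsq hqm.2
          split_ifs at hle <;> omega
    · have hfull : ∀ s : ℕ, (p : ℕ) ≤ s → numFree occ s = 0 := by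
        intro s hs
        rw [numFree, Finset.card_eq_zero, Finset.filter_eq_empty_iff]
        rintro t - ⟨h1, h2⟩
        refine h ⟨t, ?_⟩
        have : p ≤ t := by rw [Fin.le_def]; omega
        simp [freeFrom, this, h2]
      rcases k with _ | k
      · simp only [Nat.zero_le, true_iff]
        exact ⟨n, le_rfl, by rw [numFree_top]; omega⟩
      rw [Nat.add_le_add_iff_right, ih]
      constructor
      · rintro ⟨s, hs, hle⟩
        rcases le_or_gt s p with hsp | hsp
        · exact ⟨s, hs, by rw [if_pos hsp]; omega⟩
        -- Everything from `p` on is occupied, so the segment from `p` also has no free space, and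
        -- it counts the failing driver.
        · refine ⟨p, p.2.le, ?_⟩
          have h1 := hfull p le_rfl
          have h3 := countP_le_countP_of_le ps hsp.le
          rw [if_pos le_rfl]
          omega
      · rintro ⟨s, hs, hle⟩
        refine ⟨s, hs, ?_⟩
        split_ifs at hle <;> omega

/-! ### Enumeration by first passage -/

/-- The number of drivers who prefer one of the first `s` spaces. -/
def numBelow {ι : Type} [Fintype ι] {n : ℕ} (f : ι → Fin n) (s : ℕ) : ℕ :=
  (Finset.univ.filter (fun j => (f j : ℕ) < s)).card

theorem countP_ofFn {m n : ℕ} (f : Fin m → Fin n) (P : Fin n → Bool) :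
    (List.ofFn f).countP P = (Finset.univ.filter (fun j => P (f j) = true)).card := by
  rw [List.ofFn_eq_map, List.countP_map, Finset.card_def, Finset.filter_val,
    ← Multiset.countP_eq_card_filter]
  change _ = Multiset.countP _ (List.finRange m : Multiset (Fin m))
  rw [Multiset.coe_countP]
  refine List.countP_congr fun j _ => ?_
  simp

theorem le_defect_iff {m n : ℕ} (f : Fin m → Fin n) (k : ℕ) :
    k ≤ defect f ↔ ∃ s ≤ n, numBelow f s + (n + k) ≤ m + s := by
  rw [defect, le_failures_iff]
  refine exists_congr fun s => and_congr_right fun hs => ?_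
  have h1 : numFree (∅ : Finset (Fin n)) s + s = n := by
    have h := Finset.card_filter_add_card_filter_not (s := (Finset.univ : Finset (Fin n)))
      (fun t : Fin n => s ≤ (t : ℕ))
    have h2 : (Finset.univ.filter (fun t : Fin n => ¬ s ≤ (t : ℕ))).card = s := by
      simp only [not_le]
      rw [Fin.card_filter_val_lt]
      omega
    rw [h2, Finset.card_univ, Fintype.card_fin] at h
    simpa [numFree] using h
  have h2 : (List.ofFn f).countP (fun t : Fin n => s ≤ (t : ℕ)) + numBelow f s = m := by
    rw [countP_ofFn, numBelow]
    have h := Finset.card_filter_add_card_filter_not (s := (Finset.univ : Finset (Fin m)))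
      (fun j => s ≤ (f j : ℕ))
    simpa using h
  omega

theorem numBelow_le_card {ι : Type} [Fintype ι] {n : ℕ} (f : ι → Fin n) (s : ℕ) :
    numBelow f s ≤ Fintype.card ι :=
  Finset.card_filter_le _ _

theorem numBelow_mono {ι : Type} [Fintype ι] {n : ℕ} (f : ι → Fin n) : Monotone (numBelow f) := by
  intro s t hst
  refine Finset.card_le_card fun j hj => ?_
  simp only [Finset.mem_filter, Finset.mem_univ, true_and] at hj ⊢
  omega

/-- The assignments `f` for which `s - numBelow f s` does not reach `a` before `s = n`. -/
def firstPassages (ι : Type) [Fintype ι] [DecidableEq ι] (a n : ℕ) : Finset (ι → Fin n) :=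
  Finset.univ.filter (fun f => ∀ s < n, s < numBelow f s + a)

/-- The assignments `f` for which `s - numBelow f s` reaches `a` for the first time at
`s = a + I.card`, when `I` is the set of drivers who prefer one of the first `s` spaces. -/
def passagesWith {ι : Type} [Fintype ι] [DecidableEq ι] (a n : ℕ) (I : Finset ι) :
    Finset (ι → Fin n) :=
  Finset.univ.filter (fun f => (∀ j, (f j : ℕ) < a + I.card ↔ j ∈ I) ∧
    ∀ s < a + I.card, s < numBelow f s + a)

theorem numBelow_of_mem_passagesWith {ι : Type} [Fintype ι] [DecidableEq ι] {a n : ℕ}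
    {I : Finset ι} {f : ι → Fin n} (hf : f ∈ passagesWith a n I) :
    numBelow f (a + I.card) = I.card := by
  simp only [passagesWith, Finset.mem_filter, Finset.mem_univ, true_and] at hf
  rw [numBelow]
  congr 1
  ext j
  simp [hf.1 j]

/-- Sets of different sizes would give two different first passage times; with equal sizes, both
sets consist of the drivers who prefer a space before the common time. -/
theorem pairwiseDisjoint_passagesWith {ι : Type} [Fintype ι] [DecidableEq ι] (a n : ℕ)
    (S : Set (Finset ι)) : S.PairwiseDisjoint (passagesWith a n) := by
  intro I _ J _ hIJ
  refine Finset.disjoint_left.2 fun f hI hJ => hIJ ?_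
  have h1 := numBelow_of_mem_passagesWith hI
  have h2 := numBelow_of_mem_passagesWith hJ
  simp only [passagesWith, Finset.mem_filter, Finset.mem_univ, true_and] at hI hJ
  have h3 : I.card = J.card := by
    rcases lt_trichotomy I.card J.card with h | h | h
    · have := hJ.2 (a + I.card) (by omega)
      omega
    · exact h
    · have := hI.2 (a + J.card) (by omega)
      omega
  ext j
  rw [← hI.1, ← hJ.1, h3]

/-- Since `numBelow f` is monotone, `s - numBelow f s` climbs by at most one per step and cannot
jump over `a`. -/
theorem exists_mem_passagesWith_iff {ι : Type} [Fintype ι] [DecidableEq ι] {a n : ℕ} (ha : 0 < a)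
    (f : ι → Fin n) : (∃ s ≤ n, numBelow f s + a ≤ s) ↔
      ∃ I : Finset ι, a + I.card ≤ n ∧ f ∈ passagesWith a n I := by
  constructor
  · intro h
    classical
    let s := Nat.find h
    obtain ⟨hs, hle⟩ : s ≤ n ∧ numBelow f s + a ≤ s := Nat.find_spec h
    have hmin : ∀ t < s, t < numBelow f t + a := by
      intro t ht
      have := Nat.find_min h ht
      by_contra hc
      exact this ⟨ht.le.trans hs, by omega⟩
    have h1 := hmin (s - 1) (by omega)
    have h2 := numBelow_mono f (Nat.sub_le s 1)
    have h3 : a + numBelow f s = s := by omega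
    refine ⟨Finset.univ.filter (fun j => (f j : ℕ) < s), ?_, ?_⟩
    · change a + numBelow f s ≤ n
      omega
    · simp only [passagesWith, Finset.mem_filter, Finset.mem_univ, true_and]
      change (∀ j, (f j : ℕ) < a + numBelow f s ↔ _) ∧ ∀ t < a + numBelow f s, _
      rw [h3]
      exact ⟨fun j => Iff.rfl, hmin⟩
  · rintro ⟨I, hI, hf⟩
    exact ⟨a + I.card, hI, by rw [numBelow_of_mem_passagesWith hf]; omega⟩

theorem card_filter_exists_numBelow {ι : Type} [Fintype ι] [DecidableEq ι] {a n : ℕ} (ha : 0 < a)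
    [DecidablePred fun f : ι → Fin n => ∃ s ≤ n, numBelow f s + a ≤ s] :
    (Finset.univ.filter (fun f : ι → Fin n => ∃ s ≤ n, numBelow f s + a ≤ s)).card =
      ∑ I : Finset ι, if a + I.card ≤ n then (passagesWith a n I).card else 0 := by
  rw [← Finset.sum_filter, ← Finset.card_biUnion (pairwiseDisjoint_passagesWith a n _)]
  congr 1
  ext f
  simp only [Finset.mem_filter, Finset.mem_univ, true_and, Finset.mem_biUnion]
  exact exists_mem_passagesWith_iff ha f

/-- The assignment in which the drivers in `I` choose among the first `s` spaces according to `g`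
and the others choose among the remaining spaces according to `h`. -/
def glue {ι : Type} [DecidableEq ι] {n s : ℕ} (hs : s ≤ n) (I : Finset ι)
    (x : ({j // j ∈ I} → Fin s) × ({j // j ∉ I} → Fin (n - s))) : ι → Fin n :=
  fun j => if hj : j ∈ I then Fin.castLE hs (x.1 ⟨j, hj⟩)
    else ⟨s + x.2 ⟨j, hj⟩, by have := (x.2 ⟨j, hj⟩).2; omega⟩

theorem glue_injective {ι : Type} [DecidableEq ι] {n s : ℕ} (hs : s ≤ n) (I : Finset ι) :
    Function.Injective (glue hs I) := by
  rintro ⟨g, h⟩ ⟨g', h'⟩ heq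
  refine Prod.ext (funext fun j => ?_) (funext fun j => ?_)
  · have := congrArg Fin.val (congrFun heq j)
    simp only [glue, j.2, dif_pos, Fin.val_castLE] at this
    exact Fin.ext this
  · have := congrArg Fin.val (congrFun heq j)
    simp only [glue, j.2, dif_neg, not_false_eq_true] at this
    exact Fin.ext (Nat.add_left_cancel this)

theorem glue_lt_iff {ι : Type} [DecidableEq ι] {n s : ℕ} (hs : s ≤ n) (I : Finset ι)
    (x : ({j // j ∈ I} → Fin s) × ({j // j ∉ I} → Fin (n - s))) (j : ι) :
    (glue hs I x j : ℕ) < s ↔ j ∈ I := by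
  unfold glue
  split_ifs with hj
  · simp [hj]
  · simp [hj]

theorem numBelow_glue {ι : Type} [Fintype ι] [DecidableEq ι] {n s : ℕ} (hs : s ≤ n) (I : Finset ι)
    (x : ({j // j ∈ I} → Fin s) × ({j // j ∉ I} → Fin (n - s))) {t : ℕ} (ht : t ≤ s) :
    numBelow (glue hs I x) t = numBelow x.1 t := by
  rw [numBelow, numBelow, ← Finset.card_map (Function.Embedding.subtype (· ∈ I))]
  congr 1
  ext j
  simp only [Finset.mem_filter, Finset.mem_univ, true_and, Finset.mem_map,
    Function.Embedding.coe_subtype, Subtype.exists, exists_and_right, exists_eq_right]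
  constructor
  · intro h
    have hj := (glue_lt_iff hs I x j).1 (h.trans_le ht)
    refine ⟨hj, ?_⟩
    simpa [glue, hj] using h
  · rintro ⟨hj, h⟩
    simpa [glue, hj] using h

/-- The passage condition concerns only the drivers in `I` and the first `a + I.card` spaces; all
other drivers choose freely among the remaining spaces. -/
theorem card_passagesWith {ι : Type} [Fintype ι] [DecidableEq ι] {a n : ℕ} (I : Finset ι)
    (h : a + I.card ≤ n) :
    (passagesWith a n I).card = (firstPassages {j // j ∈ I} a (a + I.card)).card *
      (n - (a + I.card)) ^ (Fintype.card ι - I.card) := by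
  have himage : passagesWith a n I =
      (firstPassages {j // j ∈ I} a (a + I.card) ×ˢ Finset.univ).image (glue h I) := by
    ext f
    simp only [Finset.mem_image, Finset.mem_product, Finset.mem_univ, and_true]
    constructor
    · intro hf
      simp only [passagesWith, Finset.mem_filter, Finset.mem_univ, true_and] at hf
      have hlt : ∀ j : {j // j ∈ I}, (f j : ℕ) < a + I.card := fun j => (hf.1 j).2 j.2
      have hge : ∀ j : {j // j ∉ I}, (f j : ℕ) - (a + I.card) < n - (a + I.card) := fun j => by
        have h1 := mt (hf.1 j).1 j.2
        have h2 := (f j).2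
        omega
      have hglue : glue h I (fun j => ⟨f j, hlt j⟩, fun j => ⟨_, hge j⟩) = f := by
        funext j
        refine Fin.ext ?_
        unfold glue
        split_ifs with hj
        · simp
        · have := mt (hf.1 j).1 hj
          simp only
          omega
      refine ⟨_, ?_, hglue⟩
      simp only [firstPassages, Finset.mem_filter, Finset.mem_univ, true_and]
      intro s hs
      have h1 := hf.2 s hs
      rw [← hglue, numBelow_glue h I _ hs.le] at h1
      exact h1
    · rintro ⟨x, hx, rfl⟩
      simp only [firstPassages, Finset.mem_filter, Finset.mem_univ, true_and] at hx
      simp only [passagesWith, Finset.mem_filter, Finset.mem_univ, true_and]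
      refine ⟨glue_lt_iff h I x, fun s hs => ?_⟩
      rw [numBelow_glue h I x hs.le]
      exact hx s hs
  rw [himage, Finset.card_image_of_injective _ (glue_injective h I), Finset.card_product,
    Finset.card_univ, Fintype.card_fun, Fintype.card_fin, Fintype.card_subtype_compl,
    Fintype.card_coe]

theorem sum_ite_finset_card {ι : Type} [Fintype ι] [DecidableEq ι] (φ : ℕ → ℝ) :
    ∑ I : Finset ι, φ I.card =
      ∑ i ∈ Finset.range (Fintype.card ι + 1), ((Fintype.card ι).choose i : ℝ) * φ i := by
  rw [← Finset.powerset_univ, Finset.sum_powerset_apply_card, Finset.card_univ]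
  simp

/-- Every assignment to `a + card ι` spaces has a passage. Classifying all of them by `I` yields
Abel's sum with `c = 0`; the terms of proper subsets agree by induction, hence so does the term of
the full set, which counts the first passages. -/
theorem card_firstPassages {a : ℕ} (ha : 0 < a) (ι : Type) [Fintype ι] [DecidableEq ι] {n : ℕ}
    (hn : n = a + Fintype.card ι) :
    ((firstPassages ι a n).card : ℝ) =
      a * ((a : ℝ) + Fintype.card ι) ^ ((Fintype.card ι : ℤ) - 1) := by
  induction hc : Fintype.card ι using Nat.strong_induction_on generalizing ι n with
  | _ c ih =>
    classical
    subst hc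
    set φ : ℕ → ℝ := fun i => a * ((a : ℝ) + i) ^ ((i : ℤ) - 1) *
      (0 + ((Fintype.card ι - i : ℕ) : ℝ)) ^ (Fintype.card ι - i) with hφ
    have hcard : ∀ I : Finset ι, a + I.card ≤ n := fun I => by
      have := Finset.card_le_univ I
      omega
    have hsum : ∑ I : Finset ι, ((passagesWith a n I).card : ℝ) = ∑ I : Finset ι, φ I.card := by
      have h1 := card_filter_exists_numBelow (ι := ι) (n := n) ha
      rw [Finset.filter_true_of_mem
        fun f _ => ⟨n, le_rfl, by have := numBelow_le_card f n; omega⟩] at h1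
      simp only [hcard, if_true, Finset.card_univ, Fintype.card_fun, Fintype.card_fin] at h1
      rw [sum_ite_finset_card, ← Nat.cast_sum, ← h1]
      have h2 := abel_identity (Nat.cast_pos.2 ha) (Fintype.card ι) 0
      rw [hn]
      push_cast
      rw [add_zero] at h2
      rw [← h2]
      refine Finset.sum_congr rfl fun i _ => ?_
      rw [hφ]
      ring
    have hne : ∀ I ∈ (Finset.univ : Finset (Finset ι)).erase Finset.univ,
        ((passagesWith a n I).card : ℝ) = φ I.card := by
      intro I hI
      have hlt : I.card < Fintype.card ι := by
        rw [← Finset.card_univ]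
        exact Finset.card_lt_card (Finset.ssubset_univ_iff.2 (Finset.ne_of_mem_erase hI))
      have h1 := ih I.card hlt {j // j ∈ I} (n := a + I.card) (by rw [Fintype.card_coe])
        (Fintype.card_coe I)
      rw [card_passagesWith I (hcard I), Nat.cast_mul, h1, hφ, hn, Nat.add_sub_add_left]
      push_cast
      ring
    rw [← Finset.add_sum_erase _ _ (Finset.mem_univ Finset.univ),
      ← Finset.add_sum_erase (a := (Finset.univ : Finset ι)) _ (fun I => φ I.card)
        (Finset.mem_univ Finset.univ), Finset.sum_congr rfl hne, add_left_inj] at hsum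
    have huniv : passagesWith a n (Finset.univ : Finset ι) = firstPassages ι a n := by
      ext f
      simp [passagesWith, firstPassages, ← hn]
    rw [huniv] at hsum
    rw [hsum, hφ]
    simp

theorem card_filter_le_defect (n m k : ℕ) :
    ((Finset.univ.filter (fun f : Fin m → Fin n => k ≤ defect f)).card : ℝ) = abelSum n m k := by
  classical
  simp only [le_defect_iff]
  rw [abelSum]
  split_ifs with hk
  · rw [Finset.filter_true_of_mem fun f _ => ⟨0, Nat.zero_le n, by
      have : numBelow f 0 = 0 := by simp [numBelow]
      omega⟩]
    simp
  · obtain ⟨a, ha⟩ : ∃ a, n + k = m + a := ⟨n + k - m, by omega⟩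
    have ha0 : 0 < a := by omega
    have haR : (n : ℝ) - m + k = a := by
      have : (n : ℝ) + k = m + a := by exact_mod_cast ha
      linarith
    have hset : ∀ f : Fin m → Fin n, (∃ s ≤ n, numBelow f s + (n + k) ≤ m + s) ↔
        ∃ s ≤ n, numBelow f s + a ≤ s := fun f =>
      exists_congr fun s => and_congr_right fun _ => by omega
    simp only [hset]
    set φ : ℕ → ℝ := fun i => if a + i ≤ n then a * ((a : ℝ) + i) ^ ((i : ℤ) - 1) *
      ((n - (a + i) : ℕ) : ℝ) ^ (m - i) else 0 with hφ
    rw [card_filter_exists_numBelow ha0, Nat.cast_sum]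
    have h1 : ∀ I : Finset (Fin m),
        ((if a + I.card ≤ n then (passagesWith a n I).card else 0 : ℕ) : ℝ) = φ I.card := by
      intro I
      rw [hφ]
      split_ifs with h
      · rw [card_passagesWith I h, Nat.cast_mul,
          card_firstPassages ha0 {j // j ∈ I} (by rw [Fintype.card_coe]), Fintype.card_coe,
          Fintype.card_fin]
        simp [h]
      · simp [h]
    rw [Finset.sum_congr rfl fun I _ => h1 I, sum_ite_finset_card, Fintype.card_fin]
    symm
    -- Indices beyond `m - k` are those with `a + i > n`, where no passage fits.
    refine Finset.sum_subset_zero_on_sdiff ?_ ?_ ?_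
    · intro i hi
      simp only [Finset.mem_range] at hi ⊢
      omega
    · intro i hi
      simp only [Finset.mem_sdiff, Finset.mem_range] at hi
      rw [hφ]
      simp only
      rw [if_neg (by omega), mul_zero]
    · intro i hi
      simp only [Finset.mem_range] at hi
      rw [hφ]
      simp only
      rw [if_pos (by omega), haR]
      have : ((n - (a + i) : ℕ) : ℝ) = (m : ℝ) - k - i := by
        rw [Nat.cast_sub (by omega)]
        push_cast
        linarith
      rw [this]
      ring

theorem assignmentMeasure_real_le_defect (m n k : ℕ) :
    (assignmentMeasure m n).real {f | k ≤ defect f} = abelSum n m k / (n : ℝ) ^ m := by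
  have h := uniformOn_univ (s := {f : Fin m → Fin n | k ≤ defect f})
  rw [assignmentMeasure, Measure.real, h, ENNReal.toReal_div, ← card_filter_le_defect]
  congr 1
  · rw [Measure.count_apply_finite _ (Set.toFinite _)]
    simp
  · simp

/-! ### Rising and falling factorials -/

/-- This is `∏ (1 + j/N) ≥ 1 + ∑ j/N` over `1 ≤ j ≤ k`, cleared of denominators. -/
theorem pow_mul_le_ascFactorial (N k : ℕ) :
    N ^ k * (2 * N + k * (k + 1)) ≤ 2 * N * (N + 1).ascFactorial k := by
  induction k with
  | zero => simp
  | succ k ih =>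
    rw [Nat.ascFactorial_succ]
    calc N ^ (k + 1) * (2 * N + (k + 1) * (k + 1 + 1))
        = N ^ k * (N * (2 * N + (k + 1) * (k + 2))) := by ring
      _ ≤ N ^ k * ((N + 1 + k) * (2 * N + k * (k + 1))) := by
          refine Nat.mul_le_mul_left _ ?_
          nlinarith [Nat.zero_le (k * (k + 1) * (k + 1))]
      _ = (N + 1 + k) * (N ^ k * (2 * N + k * (k + 1))) := by ring
      _ ≤ (N + 1 + k) * (2 * N * (N + 1).ascFactorial k) := Nat.mul_le_mul_left _ ih
      _ = _ := by ring

/-- The factors pair as `(N - j)(N + j) ≤ N²`, leaving one unpaired factor `N + k`. -/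
theorem mul_descFactorial_mul_ascFactorial_le (N k : ℕ) (hk : k ≤ N) :
    (N : ℝ) * (N.descFactorial k * (N + 1).ascFactorial k) ≤ (N : ℝ) ^ (2 * k) * (N + k) := by
  induction k with
  | zero => simp
  | succ k ih =>
    have ih := ih (by omega)
    have hkN : (k : ℝ) ≤ N := by exact_mod_cast (by omega : k ≤ N)
    rw [Nat.ascFactorial_succ, Nat.descFactorial_succ, Nat.cast_mul, Nat.cast_mul,
      Nat.cast_sub (by omega)]
    push_cast
    calc _ = ((N : ℝ) - k) * (N + 1 + k) *
          (N * (N.descFactorial k * (N + 1).ascFactorial k)) := by ring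
      _ ≤ ((N : ℝ) - k) * (N + 1 + k) * ((N : ℝ) ^ (2 * k) * (N + k)) :=
          mul_le_mul_of_nonneg_left ih (mul_nonneg (by linarith) (by positivity))
      _ = (N : ℝ) ^ (2 * k) * (N + 1 + k) * (N ^ 2 - k ^ 2) := by ring
      _ ≤ (N : ℝ) ^ (2 * k) * (N + 1 + k) * N ^ 2 :=
          mul_le_mul_of_nonneg_left (by nlinarith) (by positivity)
      _ = _ := by ring

theorem le_sq_mul_descFactorial_mul_ascFactorial (N k : ℕ) (hk : k ≤ N) :
    (N : ℝ) ^ (2 * k) * (N ^ 2 - k ^ 3) ≤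
      (N : ℝ) ^ 2 * (N.descFactorial k * (N + 1).ascFactorial k) := by
  induction k with
  | zero => simp
  | succ k ih =>
    have ih := ih (by omega)
    have hkN : (k : ℝ) ≤ N := by exact_mod_cast (by omega : k ≤ N)
    rcases le_or_gt ((N : ℝ) ^ 2) (((k + 1 : ℕ) : ℝ) ^ 3) with h | h
    · exact (mul_nonpos_of_nonneg_of_nonpos (by positivity) (by linarith)).trans (by positivity)
    rw [Nat.ascFactorial_succ, Nat.descFactorial_succ, Nat.cast_mul, Nat.cast_mul,
      Nat.cast_sub (by omega)]
    push_cast at h ⊢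
    have hk0 : (0 : ℝ) ≤ k := k.cast_nonneg
    have h3 : (0 : ℝ) ≤ N ^ 2 - k ^ 3 := by nlinarith [pow_nonneg hk0 2]
    calc (N : ℝ) ^ (2 * (k + 1)) * (N ^ 2 - (k + 1) ^ 3)
        = (N : ℝ) ^ (2 * k) * (N ^ 2 * (N ^ 2 - (k + 1) ^ 3)) := by ring
      _ ≤ (N : ℝ) ^ (2 * k) * ((N ^ 2 - k ^ 2) * (N ^ 2 - k ^ 3)) := by
          refine mul_le_mul_of_nonneg_left ?_ (by positivity)
          nlinarith [pow_nonneg hk0 5, mul_nonneg (sq_nonneg (N : ℝ)) hk0,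
            mul_nonneg (sq_nonneg (N : ℝ)) (sq_nonneg (k : ℝ)), sq_nonneg (N : ℝ)]
      _ ≤ (N : ℝ) ^ (2 * k) * (((N - k) * (N + 1 + k)) * (N ^ 2 - k ^ 3)) := by
          refine mul_le_mul_of_nonneg_left (mul_le_mul_of_nonneg_right ?_ h3) (by positivity)
          nlinarith
      _ = ((N - k) * (N + 1 + k)) * ((N : ℝ) ^ (2 * k) * (N ^ 2 - k ^ 3)) := by ring
      _ ≤ ((N - k) * (N + 1 + k)) *
            ((N : ℝ) ^ 2 * (N.descFactorial k * (N + 1).ascFactorial k)) :=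
          mul_le_mul_of_nonneg_left ih (mul_nonneg (by linarith) (by positivity))
      _ = _ := by ring

/-- The falling and the rising factorial of length `k` deviate from the power by almost reciprocal
factors, uniformly in the base. -/
theorem abs_descFactorial_div_sub_div_ascFactorial_le (N k : ℕ) (hk : 0 < k) :
    |(N.descFactorial k : ℝ) / N ^ k - (N : ℝ) ^ k / (N + 1).ascFactorial k| ≤ 2 / √(k : ℝ) := by
  have hk1 : (1 : ℝ) ≤ k := by exact_mod_cast hk
  set w := √(k : ℝ) with hw
  have hw2 : w ^ 2 = k := Real.sq_sqrt (by linarith)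
  have hw1 : 1 ≤ w := Real.one_le_sqrt.2 hk1
  rcases Nat.eq_zero_or_pos N with rfl | hN
  · rw [Nat.descFactorial_eq_zero_iff_lt.2 hk]
    simp [hk.ne']
    positivity
  have hN0 : (0 : ℝ) < N := by exact_mod_cast hN
  set D : ℝ := ((N + 1).ascFactorial k : ℝ) with hD
  have hD0 : 0 < D := by rw [hD]; exact_mod_cast Nat.ascFactorial_pos _ _
  set g : ℝ := (N : ℝ) ^ k / D with hg
  have hg0 : 0 < g := by positivity
  have hgle : g ≤ 2 * N / k ^ 2 := by
    have h1 : (N : ℝ) ^ k * (2 * N + k * (k + 1)) ≤ 2 * N * D := by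
      rw [hD]; exact_mod_cast pow_mul_le_ascFactorial N k
    rw [hg, div_le_div_iff₀ hD0 (by positivity)]
    refine le_trans (mul_le_mul_of_nonneg_left ?_ (by positivity)) h1
    nlinarith
  rcases lt_or_ge N k with hNk | hNk
  · rw [Nat.descFactorial_eq_zero_iff_lt.2 hNk, Nat.cast_zero, zero_div, zero_sub, abs_neg,
      abs_of_pos hg0]
    refine hgle.trans ?_
    have : (N : ℝ) ≤ k := by exact_mod_cast hNk.le
    rw [← hw2] at this ⊢
    rw [div_le_div_iff₀ (by positivity) (by positivity)]
    nlinarith [mul_le_mul_of_nonneg_right this (by positivity : (0 : ℝ) ≤ w),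
      pow_pos (zero_lt_one.trans_le hw1) 3]
  set R : ℝ := (N.descFactorial k : ℝ) / N ^ k * (D / N ^ k) with hR
  have hsplit : (N.descFactorial k : ℝ) / N ^ k - g = g * (R - 1) := by
    rw [hR, hg]
    field_simp
  have hR0 : 0 ≤ R := by positivity
  have hRle : R - 1 ≤ k / N := by
    have := mul_descFactorial_mul_ascFactorial_le N k hNk
    rw [hR, div_mul_div_comm, ← pow_add, ← two_mul, sub_le_iff_le_add, div_le_iff₀ (by positivity)]
    rw [← mul_le_mul_iff_right₀ hN0]
    refine this.trans (le_of_eq ?_)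
    field_simp
    ring
  have hRge : -(k ^ 3 / N ^ 2 : ℝ) ≤ R - 1 := by
    have := le_sq_mul_descFactorial_mul_ascFactorial N k hNk
    rw [hR, div_mul_div_comm, ← pow_add, ← two_mul, neg_le_sub_iff_le_add,
      ← sub_le_iff_le_add, le_div_iff₀ (by positivity)]
    rw [← mul_le_mul_iff_right₀ (pow_pos hN0 2)]
    refine le_trans (le_of_eq ?_) this
    field_simp
  rw [hsplit, abs_mul, abs_of_pos hg0]
  -- The bounds `g ≤ 2N/k²` and `|R - 1| ≤ min(1, k^(3/2)/N)` balance at `N = k^(3/2)`; on either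
  -- side the product is at most `2/√k`.
  rcases le_or_gt (N : ℝ) (w ^ 3) with h | h
  · have h1 : |R - 1| ≤ 1 := by
      rw [abs_le]
      refine ⟨by linarith, hRle.trans ((div_le_one hN0).2 (by exact_mod_cast hNk))⟩
    calc g * |R - 1| ≤ 2 * N / k ^ 2 * 1 :=
          mul_le_mul hgle h1 (abs_nonneg _) (by positivity)
      _ ≤ 2 / w := by
          rw [← hw2, mul_one, div_le_div_iff₀ (by positivity) (by positivity)]
          nlinarith [mul_le_mul_of_nonneg_right h (by positivity : (0 : ℝ) ≤ w)]
  · have h1 : |R - 1| ≤ w ^ 3 / N := by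
      rw [abs_le]
      constructor
      · refine le_trans (neg_le_neg ?_) hRge
        rw [← hw2, div_le_div_iff₀ (by positivity) (by positivity)]
        nlinarith [mul_le_mul_of_nonneg_left h.le (by positivity : (0 : ℝ) ≤ w ^ 3 * N)]
      · refine hRle.trans (div_le_div_of_nonneg_right ?_ hN0.le)
        rw [← hw2]
        exact pow_le_pow_right₀ hw1 (by norm_num)
    calc g * |R - 1| ≤ 2 * N / k ^ 2 * (w ^ 3 / N) :=
          mul_le_mul hgle h1 (abs_nonneg _) (by positivity)
      _ = 2 / w := by
          rw [← hw2]
          field_simp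

/-! ### Comparison of the sum with a falling factorial -/

/-- Both sides equal `(i + N + k)! / (i! N!)`. -/
theorem choose_mul_ascFactorial (i N k : ℕ) :
    (i + N + k).choose i * (N + 1).ascFactorial k =
      (i + N).choose i * (i + N + k).descFactorial k := by
  have h1 := Nat.factorial_mul_ascFactorial N k
  have h2 := Nat.factorial_mul_descFactorial (Nat.le_add_left k (i + N))
  rw [Nat.add_sub_cancel] at h2
  have h3 := Nat.add_choose_mul_factorial_mul_factorial i N
  have h4 := Nat.add_choose_mul_factorial_mul_factorial i (N + k)
  rw [← Nat.choose_symm_add] at h3 h4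
  rw [← add_assoc] at h4
  refine Nat.eq_of_mul_eq_mul_right (Nat.mul_pos i.factorial_pos N.factorial_pos) ?_
  calc _ = (i + N + k).choose i * i.factorial * (N.factorial * (N + 1).ascFactorial k) := by ring
    _ = (i + N).choose i * i.factorial * N.factorial * (i + N + k).descFactorial k := by
        rw [h1, h4, h3, h2]
    _ = _ := by ring

/-- Here `n = a + p + k` and `m = p + 2k`, so `a = n - m + k` and no truncated subtraction occurs.
-/
theorem abs_abelSum_div_sub_le {a k p : ℕ} (ha : 0 < a) (hk : 0 < k) :
    |abelSum (a + (p + k)) (p + k + k) k / ((a + (p + k) : ℕ) : ℝ) ^ (p + k + k) -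
        ((p + k + k).descFactorial (2 * k) : ℝ) / ((a + (p + k) : ℕ) : ℝ) ^ (2 * k)| ≤
      ((p + k + k).descFactorial k : ℝ) / ((a + (p + k) : ℕ) : ℝ) ^ k * (2 / √(k : ℝ)) := by
  obtain ⟨r, hr⟩ : ∃ r, r = p + k := ⟨_, rfl⟩
  rw [← hr]
  set n : ℝ := ((a + r : ℕ) : ℝ) with hn
  have hn0 : 0 < n := by rw [hn]; exact_mod_cast (by omega : 0 < a + r)
  have ha0 : (0 : ℝ) < a := by exact_mod_cast ha
  set w : ℕ → ℝ := fun i => a * ((a : ℝ) + i) ^ ((i : ℤ) - 1) with hw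
  have hw0 : ∀ i, 0 < w i := fun i => by positivity
  set q : ℕ → ℝ := fun i => (r.choose i : ℝ) * w i * ((r - i : ℕ) : ℝ) ^ (r - i) / n ^ r with hq
  have hq0 : ∀ i, 0 ≤ q i := fun i => by have := hw0 i; positivity
  have hqsum : ∑ i ∈ Finset.range (r + 1), q i = 1 := by
    have h := abel_identity ha0 r 0
    simp only [zero_add, add_zero] at h
    rw [hq, ← Finset.sum_div, div_eq_one_iff_eq (by positivity), hn]
    push_cast
    rw [← h]
    exact Finset.sum_congr rfl fun i _ => by rw [hw]; ring
  set g : ℕ → ℝ := fun N => (N : ℝ) ^ k / (N + 1).ascFactorial k with hg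
  set h : ℕ → ℝ := fun N => (N.descFactorial k : ℝ) / (N : ℝ) ^ k with hh
  set A : ℝ := ((r + k).descFactorial k : ℝ) / n ^ k with hA
  have hS : abelSum (a + r) (r + k) k / n ^ (r + k) =
      A * ∑ i ∈ Finset.range (r + 1), g (r - i) * q i := by
    rw [abelSum, if_neg (by omega), Finset.sum_div, Finset.mul_sum,
      show r + k + 1 - k = r + 1 by omega]
    refine Finset.sum_congr rfl fun i hi => ?_
    obtain ⟨N, hN⟩ : ∃ N, r = i + N := ⟨r - i, by have := Finset.mem_range.1 hi; omega⟩
    have e1 : r - i = N := by omega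
    have e2 : r + k - i = N + k := by omega
    have e3 : ((a + r : ℕ) : ℝ) - ((r + k : ℕ) : ℝ) + k = a := by push_cast; ring
    have e4 : ((r + k : ℕ) : ℝ) - k - i = N := by rw [hN]; push_cast; ring
    have hc : ((r + k).choose i : ℝ) * (N + 1).ascFactorial k =
        r.choose i * (r + k).descFactorial k := by
      rw [hN]; exact_mod_cast choose_mul_ascFactorial i N k
    have hD0 : (0 : ℝ) < (N + 1).ascFactorial k := by exact_mod_cast Nat.ascFactorial_pos _ _
    rw [e2, e3, e4, hA, hq, hg, hw]
    simp only [e1]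
    rw [← eq_div_iff hD0.ne'] at hc
    rw [hc, pow_add, pow_add]
    field_simp
  -- The factor `(r - i)_k` kills the terms with `i > p` and turns `C(r,i)` into `C(p,i)`; what
  -- remains is Abel's sum for `M = p`, `c = k`.
  have hH : ∑ i ∈ Finset.range (r + 1), h (r - i) * q i = (r.descFactorial k : ℝ) / n ^ k := by
    have hab := abel_identity ha0 p k
    have e : (a : ℝ) + k + p = n := by rw [hn, hr]; push_cast; ring
    rw [e] at hab
    have hsub : ∑ i ∈ Finset.range (p + 1), h (r - i) * q i =
        ∑ i ∈ Finset.range (r + 1), h (r - i) * q i := by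
      refine Finset.sum_subset (Finset.range_subset_range.2 (by omega)) fun i _ hi => ?_
      rw [Finset.mem_range] at hi
      rw [hh]
      simp only
      rw [Nat.descFactorial_eq_zero_iff_lt.2 (by omega), Nat.cast_zero, zero_div, zero_mul]
    have hnr : n ^ r = n ^ p * n ^ k := by rw [hr, pow_add]
    rw [← hsub, eq_div_iff (by positivity), Finset.sum_mul]
    have : (r.descFactorial k : ℝ) = (r.descFactorial k : ℝ) / n ^ p * _ :=
      (div_mul_cancel₀ _ (by positivity)).symm.trans (congrArg _ hab.symm)
    rw [this, Finset.mul_sum]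
    refine Finset.sum_congr rfl fun i hi => ?_
    obtain ⟨N, hN⟩ : ∃ N, p = i + N := ⟨p - i, by have := Finset.mem_range.1 hi; omega⟩
    have e1 : r - i = N + k := by omega
    have e2 : p - i = N := by omega
    have hc : (p.choose i : ℝ) * r.descFactorial k = r.choose i * (N + k).descFactorial k := by
      rw [hr, hN, Nat.add_descFactorial_eq_ascFactorial N k]
      have := choose_mul_ascFactorial i N k
      exact_mod_cast this.symm
    have hNk : (0 : ℝ) < ((N + k : ℕ) : ℝ) := by exact_mod_cast (by omega : 0 < N + k)
    rw [hq, hh]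
    simp only [e1, e2]
    rw [hnr, pow_add ((N + k : ℕ) : ℝ) N k]
    have hcomm : (k : ℝ) + N = ((N + k : ℕ) : ℝ) := by push_cast; ring
    rw [hcomm, hw]
    simp only
    field_simp
    linear_combination -hc
  have hdesc : ((r + k).descFactorial (2 * k) : ℝ) / n ^ (2 * k) =
      A * ((r.descFactorial k : ℝ) / n ^ k) := by
    have := Nat.descFactorial_mul_descFactorial (n := r + k) (k := k) (m := 2 * k) (by omega)
    rw [Nat.add_sub_cancel, show 2 * k - k = k by omega] at this
    rw [← this, hA, two_mul, pow_add]
    push_cast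
    field_simp
  rw [hS, hdesc, ← hH, ← mul_sub, ← Finset.sum_sub_distrib, abs_mul,
    abs_of_nonneg (by positivity : 0 ≤ A)]
  refine mul_le_mul_of_nonneg_left ?_ (by positivity)
  calc _ ≤ ∑ i ∈ Finset.range (r + 1), |g (r - i) * q i - h (r - i) * q i| :=
        Finset.abs_sum_le_sum_abs _ _
    _ ≤ ∑ i ∈ Finset.range (r + 1), 2 / √(k : ℝ) * q i := by
        refine Finset.sum_le_sum fun i _ => ?_
        rw [← sub_mul, abs_mul, abs_of_nonneg (hq0 i), abs_sub_comm]
        exact mul_le_mul_of_nonneg_right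
          (abs_descFactorial_div_sub_div_ascFactorial_le _ _ hk) (hq0 i)
    _ = 2 / √(k : ℝ) := by rw [← Finset.mul_sum, hqsum, mul_one]

/-! ### Limits on the scale of `√n` -/

theorem abs_log_one_add_sub_le {t : ℝ} (ht : |t| ≤ 1 / 2) : |Real.log (1 + t) - t| ≤ 2 * t ^ 2 := by
  obtain ⟨h1, h2⟩ := abs_le.1 ht
  have hpos : 0 < 1 + t := by linarith
  have hle := Real.log_le_sub_one_of_pos hpos
  have hge := Real.one_sub_inv_le_log_of_pos hpos
  have h3 : t - 2 * t ^ 2 ≤ 1 - (1 + t)⁻¹ := by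
    rw [inv_eq_one_div, one_sub_div hpos.ne', le_div_iff₀ hpos]
    nlinarith [mul_nonneg (sq_nonneg t) (by linarith : 0 ≤ 1 + 2 * t)]
  rw [abs_le]
  constructor <;> nlinarith [sq_nonneg t]

theorem tendsto_sqrt_natCast_atTop : Tendsto (fun n : ℕ => √(n : ℝ)) atTop atTop :=
  Real.tendsto_sqrt_atTop.comp tendsto_natCast_atTop_atTop

theorem eventually_sqrt_natCast_pos : ∀ᶠ n : ℕ in atTop, 0 < √(n : ℝ) :=
  tendsto_sqrt_natCast_atTop.eventually_gt_atTop 0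

/-- The quotient is `∏ (1 + T n j)` with `T n j = (m - n - j)/n`. The sum of the `T n j` tends to
`zy - z²/2`, and their squares sum to `O(1/√n)`. -/
theorem tendsto_descFactorial_div_pow {m d : ℕ → ℕ} {y z : ℝ}
    (hm : Tendsto (fun n : ℕ => ((m n : ℝ) - n) / √(n : ℝ)) atTop (𝓝 y))
    (hd : Tendsto (fun n : ℕ => (d n : ℝ) / √(n : ℝ)) atTop (𝓝 z)) :
    Tendsto (fun n : ℕ => ((m n).descFactorial (d n) : ℝ) / (n : ℝ) ^ d n) atTop
      (𝓝 (Real.exp (z * y - z ^ 2 / 2))) := by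
  set v : ℕ → ℝ := fun n => |((m n : ℝ) - n) / √(n : ℝ)| + d n / √(n : ℝ) with hv
  have hvlim : Tendsto v atTop (𝓝 (|y| + z)) := hm.abs.add hd
  have hinv : Tendsto (fun n : ℕ => (√(n : ℝ))⁻¹) atTop (𝓝 0) :=
    tendsto_inv_atTop_zero.comp tendsto_sqrt_natCast_atTop
  have hτ : Tendsto (fun n => v n * (√(n : ℝ))⁻¹) atTop (𝓝 0) := by
    simpa using hvlim.mul hinv
  have herr : Tendsto (fun n : ℕ => 2 * ((d n : ℝ) / √(n : ℝ) * v n ^ 2 * (√(n : ℝ))⁻¹)) atTop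
      (𝓝 0) := by
    simpa using ((hd.mul (hvlim.pow 2)).mul hinv).const_mul 2
  set T : ℕ → ℕ → ℝ := fun n j => ((m n : ℝ) - n - j) / n with hT
  have hmain : Tendsto (fun n => ∑ j ∈ Finset.range (d n), T n j) atTop
      (𝓝 (z * y - z ^ 2 / 2)) := by
    have h1 : Tendsto (fun n : ℕ => (d n : ℝ) / √(n : ℝ) * (((m n : ℝ) - n) / √(n : ℝ)) -
        ((d n : ℝ) / √(n : ℝ)) ^ 2 / 2 + (d n : ℝ) / √(n : ℝ) * (√(n : ℝ))⁻¹ / 2) atTop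
        (𝓝 (z * y - z ^ 2 / 2)) := by
      simpa using ((hd.mul hm).sub ((hd.pow 2).div_const 2)).add ((hd.mul hinv).div_const 2)
    refine h1.congr' ?_
    filter_upwards [eventually_sqrt_natCast_pos] with n hn
    have hs : (√(n : ℝ)) ^ 2 = n := Real.sq_sqrt n.cast_nonneg
    have hsum : ∀ D : ℕ, ∑ j ∈ Finset.range D, (j : ℝ) = D * (D - 1) / 2 := by
      intro D
      induction D with
      | zero => simp
      | succ D ih => rw [Finset.sum_range_succ, ih]; push_cast; ring
    rw [hT]
    simp only
    rw [← Finset.sum_div, Finset.sum_sub_distrib, hsum, Finset.sum_const, Finset.card_range,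
      nsmul_eq_mul]
    set s := √(n : ℝ)
    rw [← hs]
    field_simp
    ring
  have hclose : ∀ᶠ n in atTop, 0 < ((m n).descFactorial (d n) : ℝ) / (n : ℝ) ^ d n ∧
      |Real.log (((m n).descFactorial (d n) : ℝ) / (n : ℝ) ^ d n) -
        ∑ j ∈ Finset.range (d n), T n j| ≤
      2 * ((d n : ℝ) / √(n : ℝ) * v n ^ 2 * (√(n : ℝ))⁻¹) := by
    filter_upwards [eventually_sqrt_natCast_pos,
      hτ.eventually_le_const (by norm_num : (0 : ℝ) < 1 / 2)] with n hn hsmall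
    have hs : (√(n : ℝ)) ^ 2 = n := Real.sq_sqrt n.cast_nonneg
    have hn0 : (0 : ℝ) < n := by rw [← hs]; positivity
    have hTle : ∀ j ∈ Finset.range (d n), |T n j| ≤ v n * (√(n : ℝ))⁻¹ := by
      intro j hj
      have hj' : (j : ℝ) ≤ d n := by exact_mod_cast (Finset.mem_range.1 hj).le
      have e : v n * (√(n : ℝ))⁻¹ = (|(m n : ℝ) - n| + d n) / n := by
        rw [hv]
        simp only
        rw [abs_div, abs_of_pos hn]
        rw [← add_div, ← div_eq_mul_inv, div_div, Real.mul_self_sqrt n.cast_nonneg]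
      rw [e, hT]
      simp only
      rw [abs_div, abs_of_pos hn0]
      refine div_le_div_of_nonneg_right ?_ hn0.le
      refine (abs_sub _ _).trans ?_
      rw [abs_of_nonneg (j.cast_nonneg : (0 : ℝ) ≤ j)]
      linarith
    have hTpos : ∀ j ∈ Finset.range (d n), 0 < 1 + T n j := fun j hj => by
      have := (abs_le.1 ((hTle j hj).trans hsmall)).1
      linarith
    have hprod : ((m n).descFactorial (d n) : ℝ) / (n : ℝ) ^ d n =
        ∏ j ∈ Finset.range (d n), (1 + T n j) := by
      have hcard : (n : ℝ) ^ d n = ∏ j ∈ Finset.range (d n), (n : ℝ) := by simp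
      rw [Nat.descFactorial_eq_prod_range, Nat.cast_prod, hcard, ← Finset.prod_div_distrib]
      refine Finset.prod_congr rfl fun j hj => ?_
      have e : 1 + T n j = ((m n : ℝ) - j) / n := by
        rw [hT]
        field_simp
        ring
      -- Positivity of the factor ensures that the subtraction `m n - j` in ℕ is not truncated.
      have hjm : j ≤ m n := by
        have := hTpos j hj
        rw [e] at this
        have h2 : (0 : ℝ) < m n - j := by
          by_contra hc
          exact absurd this (not_lt.2 (div_nonpos_of_nonpos_of_nonneg (not_lt.1 hc) hn0.le))
        exact_mod_cast (sub_pos.1 h2).le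
      rw [e, Nat.cast_sub hjm]
    rw [hprod]
    refine ⟨Finset.prod_pos hTpos, ?_⟩
    rw [Real.log_prod fun j hj => (hTpos j hj).ne', ← Finset.sum_sub_distrib]
    calc _ ≤ ∑ j ∈ Finset.range (d n), |Real.log (1 + T n j) - T n j| :=
          Finset.abs_sum_le_sum_abs _ _
      _ ≤ ∑ j ∈ Finset.range (d n), 2 * (v n * (√(n : ℝ))⁻¹) ^ 2 := by
          refine Finset.sum_le_sum fun j hj => ?_
          refine (abs_log_one_add_sub_le ((hTle j hj).trans hsmall)).trans ?_
          rw [← sq_abs]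
          have := pow_le_pow_left₀ (abs_nonneg _) (hTle j hj) 2
          linarith
      _ = _ := by
          rw [Finset.sum_const, Finset.card_range, nsmul_eq_mul]
          field_simp
  have hlog : Tendsto (fun n => Real.log (((m n).descFactorial (d n) : ℝ) / (n : ℝ) ^ d n)) atTop
      (𝓝 (z * y - z ^ 2 / 2)) := by
    have h0 := squeeze_zero_norm' (hclose.mono fun n hn => by
      rw [Real.norm_eq_abs]; exact hn.2) herr
    simpa using h0.add hmain
  refine ((Real.continuous_exp.tendsto _).comp hlog).congr' ?_
  filter_upwards [hclose] with n hn
  exact Real.exp_log hn.1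

theorem tendsto_abelSum_div_pow {m k : ℕ → ℕ} {x y : ℝ} (hx : 0 < x) (hxy : y < x)
    (hm : Tendsto (fun n : ℕ => ((m n : ℝ) - n) / √(n : ℝ)) atTop (𝓝 y))
    (hk : Tendsto (fun n : ℕ => (k n : ℝ) / √(n : ℝ)) atTop (𝓝 x)) :
    Tendsto (fun n : ℕ => abelSum n (m n) (k n) / (n : ℝ) ^ m n) atTop
      (𝓝 (Real.exp (-2 * x * (x - y)))) := by
  have hk2 : Tendsto (fun n : ℕ => ((2 * k n : ℕ) : ℝ) / √(n : ℝ)) atTop (𝓝 (2 * x)) := by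
    refine (hk.const_mul 2).congr fun n => ?_
    push_cast
    ring
  have hmain := tendsto_descFactorial_div_pow hm hk2
  rw [show 2 * x * y - (2 * x) ^ 2 / 2 = -2 * x * (x - y) by ring] at hmain
  have hktop : Tendsto (fun n => (k n : ℝ)) atTop atTop := by
    refine (hk.pos_mul_atTop hx tendsto_sqrt_natCast_atTop).congr' ?_
    filter_upwards [eventually_sqrt_natCast_pos] with n hn
    field_simp
  have herr : Tendsto (fun n : ℕ => ((m n).descFactorial (k n) : ℝ) / (n : ℝ) ^ k n *
      (2 / √(k n : ℝ))) atTop (𝓝 0) := by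
    have h1 := (tendsto_const_nhds (x := (2 : ℝ))).div_atTop (Real.tendsto_sqrt_atTop.comp hktop)
    simpa using (tendsto_descFactorial_div_pow hm hk).mul h1
  have hlt : ∀ᶠ n : ℕ in atTop, (m n : ℝ) < n + k n := by
    filter_upwards [eventually_sqrt_natCast_pos,
      (hk.sub hm).eventually_const_lt (sub_pos.2 hxy)] with n hn h
    rw [← sub_div, div_pos_iff_of_pos_right hn] at h
    linarith
  have hle : ∀ᶠ n : ℕ in atTop, (2 * k n : ℝ) ≤ m n := by
    have h := (tendsto_sqrt_natCast_atTop.atTop_add (hm.sub (hk.const_mul 2))).eventually_ge_atTop 0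
    filter_upwards [eventually_sqrt_natCast_pos, h] with n hn h
    have hs : √(n : ℝ) * √(n : ℝ) = n := Real.mul_self_sqrt n.cast_nonneg
    have h2 := mul_nonneg h hn.le
    have e : (√(n : ℝ) + (((m n : ℝ) - n) / √(n : ℝ) - 2 * (k n / √(n : ℝ)))) * √(n : ℝ) =
        √(n : ℝ) * √(n : ℝ) + ((m n - n) - 2 * k n) := by
      field_simp
    rw [e, hs] at h2
    linarith
  have hdiff := squeeze_zero_norm' (f := fun n => abelSum n (m n) (k n) / (n : ℝ) ^ m n -
    ((m n).descFactorial (2 * k n) : ℝ) / (n : ℝ) ^ (2 * k n)) ?_ herr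
  · simpa using hdiff.add hmain
  filter_upwards [hlt, hle, hktop.eventually_gt_atTop 0] with n h1 h2 h3
  have h1' : m n < n + k n := by exact_mod_cast h1
  have h2' : 2 * k n ≤ m n := by exact_mod_cast h2
  have h3' : 0 < k n := by exact_mod_cast h3
  have h := abs_abelSum_div_sub_le (a := n + k n - m n) (k := k n) (p := m n - 2 * k n)
    (by omega) h3'
  have e1 : n + k n - m n + (m n - 2 * k n + k n) = n := by omega
  have e2 : m n - 2 * k n + k n + k n = m n := by omega
  rw [e1, e2] at h
  exact h

theorem tendsto_numDrivers (y : ℝ) :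
    Tendsto (fun n : ℕ => ((numDrivers y n : ℝ) - n) / √(n : ℝ)) atTop (𝓝 y) := by
  have h0 : ∀ᶠ n : ℕ in atTop, ((numDrivers y n : ℝ) - n) = ⌊y * √(n : ℝ)⌋ := by
    filter_upwards [tendsto_sqrt_natCast_atTop.eventually_ge_atTop (|y| + 1)] with n hn
    have hs : √(n : ℝ) * √(n : ℝ) = n := Real.mul_self_sqrt n.cast_nonneg
    have h1 := Int.lt_floor_add_one (y * √(n : ℝ))
    have h2 := neg_abs_le y
    have h3 : 0 ≤ (n : ℤ) + ⌊y * √(n : ℝ)⌋ := by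
      have : (0 : ℝ) ≤ ((n : ℤ) + ⌊y * √(n : ℝ)⌋ : ℤ) := by
        push_cast
        nlinarith [abs_nonneg y]
      exact_mod_cast this
    have h4 : ((numDrivers y n : ℕ) : ℤ) = (n : ℤ) + ⌊y * √(n : ℝ)⌋ := Int.toNat_of_nonneg h3
    have h5 : (numDrivers y n : ℝ) = n + (⌊y * √(n : ℝ)⌋ : ℝ) := by exact_mod_cast h4
    rw [h5]
    ring
  have hinv : Tendsto (fun n : ℕ => y - (√(n : ℝ))⁻¹) atTop (𝓝 y) := by
    simpa using tendsto_const_nhds.sub (tendsto_inv_atTop_zero.comp tendsto_sqrt_natCast_atTop)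
  refine tendsto_of_tendsto_of_tendsto_of_le_of_le' hinv tendsto_const_nhds ?_ ?_
  · filter_upwards [h0, eventually_sqrt_natCast_pos] with n h hn
    rw [h, le_div_iff₀ hn, sub_mul, inv_mul_cancel₀ hn.ne']
    linarith [Int.lt_floor_add_one (y * √(n : ℝ))]
  · filter_upwards [h0, eventually_sqrt_natCast_pos] with n h hn
    rw [h, div_le_iff₀ hn]
    exact Int.floor_le _

theorem tendsto_natFloor_mul_sqrt_div {x : ℝ} (hx : 0 ≤ x) :
    Tendsto (fun n : ℕ => (⌊x * √(n : ℝ)⌋₊ : ℝ) / √(n : ℝ)) atTop (𝓝 x) :=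
  (tendsto_nat_floor_mul_div_atTop hx).comp tendsto_sqrt_natCast_atTop

theorem tendsto_abelSum_numDrivers {x : ℝ} (hx : 0 < x) (y : ℝ) :
    Tendsto (fun n : ℕ => abelSum n (numDrivers y n) ⌊x * √(n : ℝ)⌋₊ / (n : ℝ) ^ numDrivers y n)
      atTop (𝓝 (if y < x then Real.exp (-2 * x * (x - y)) else 1)) := by
  split_ifs with hxy
  · exact tendsto_abelSum_div_pow hx hxy (tendsto_numDrivers y)
      (tendsto_natFloor_mul_sqrt_div hx.le)
  · refine tendsto_const_nhds.congr' ?_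
    filter_upwards [eventually_gt_atTop 0] with n hn
    -- For `x ≤ y` there are always at least `k` more drivers than spaces, so the probability is
    -- exactly `1`.
    have hle : n + ⌊x * √(n : ℝ)⌋₊ ≤ numDrivers y n := by
      have h1 : ⌊x * √(n : ℝ)⌋ ≤ ⌊y * √(n : ℝ)⌋ :=
        Int.floor_mono (mul_le_mul_of_nonneg_right (not_lt.1 hxy) (Real.sqrt_nonneg _))
      have h2 : ((⌊x * √(n : ℝ)⌋₊ : ℕ) : ℤ) = ⌊x * √(n : ℝ)⌋ :=
        Int.natCast_floor_eq_floor (by positivity)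
      rw [numDrivers]
      omega
    have hn0 : (n : ℝ) ≠ 0 := by exact_mod_cast hn.ne'
    rw [abelSum, if_pos hle, div_self (pow_ne_zero _ hn0)]

/-! ### Convergence in distribution -/

/-- Differences of tails give the masses of intervals `(a, b]` with endpoints in `D`; these form a
π-system containing small neighbourhoods of every point. -/
theorem tendsto_probabilityMeasure_of_tendsto_Ioi {ι : Type*} {l : Filter ι}
    [l.IsCountablyGenerated] {μ : ι → ProbabilityMeasure ℝ} {ν : ProbabilityMeasure ℝ} {D : Set ℝ}
    (hD : Dense D) (h : ∀ t ∈ D, Tendsto (fun i => (μ i : Measure ℝ).real (Set.Ioi t)) l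
      (𝓝 ((ν : Measure ℝ).real (Set.Ioi t)))) : Tendsto μ l (𝓝 ν) := by
  refine (isPiSystem_Ioc_mem D D).tendsto_probabilityMeasure_of_tendsto_of_mem ?_ ?_ ?_
  · rintro _ ⟨a, -, b, -, -, rfl⟩
    exact measurableSet_Ioc
  · intro u hu x hx
    obtain ⟨a, b, hab, hsub⟩ := mem_nhds_iff_exists_Ioo_subset.1 (hu.mem_nhds hx)
    obtain ⟨a', ha', haa, hax⟩ := hD.exists_between hab.1
    obtain ⟨b', hb', hxb, hbb⟩ := hD.exists_between hab.2
    refine ⟨Set.Ioc a' b', ⟨a', ha', b', hb', hax.trans hxb, rfl⟩, Ioc_mem_nhds hax hxb, ?_⟩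
    exact fun z hz => hsub ⟨haa.trans hz.1, hz.2.trans_lt hbb⟩
  · rintro _ ⟨a, ha, b, hb, hab, rfl⟩
    have hIoc : ∀ ρ : ProbabilityMeasure ℝ, ((ρ (Set.Ioc a b) : NNReal) : ℝ) =
        (ρ : Measure ℝ).real (Set.Ioi a) - (ρ : Measure ℝ).real (Set.Ioi b) := by
      intro ρ
      rw [← measureReal_sdiff (Set.Ioi_subset_Ioi hab.le) measurableSet_Ioi, Set.Ioi_sdiff_Ioi]
      rfl
    rw [← NNReal.tendsto_coe]
    simp only [hIoc]
    exact (h a ha).sub (h b hb)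

theorem rayleighMeasure_half_Ioi {t : ℝ} (ht : 0 ≤ t) :
    (rayleighMeasure (1 / 2)).real (Set.Ioi t) = Real.exp (-2 * t ^ 2) := by
  set ψ : ℝ → ℝ := fun s => s / (1 / 2) ^ 2 * Real.exp (-s ^ 2 / (2 * (1 / 2) ^ 2)) with hψ
  have hd : ∀ s ∈ Set.Ici t, HasDerivAt (fun s : ℝ => -Real.exp (-2 * s ^ 2)) (ψ s) s := by
    intro s _
    have h1 : HasDerivAt (fun s : ℝ => -2 * s ^ 2) (-2 * (2 * s)) s := by
      simpa using (hasDerivAt_pow 2 s).const_mul (-2)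
    refine h1.exp.neg.congr_deriv ?_
    rw [hψ]
    simp only
    rw [show -s ^ 2 / (2 * (1 / 2) ^ 2) = -2 * s ^ 2 by ring]
    ring
  have hpos : ∀ s ∈ Set.Ioi t, 0 ≤ ψ s := by
    intro s hs
    have : 0 < s := ht.trans_lt hs
    positivity
  have hlim : Tendsto (fun s : ℝ => -Real.exp (-2 * s ^ 2)) atTop (𝓝 0) := by
    rw [← neg_zero]
    refine (Real.tendsto_exp_atBot.comp ?_).neg
    exact (tendsto_pow_atTop two_ne_zero).const_mul_atTop_of_neg (by norm_num)
  have hint := integrableOn_Ioi_deriv_of_nonneg' hd hpos hlim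
  have hval := integral_Ioi_of_hasDerivAt_of_nonneg' hd hpos hlim
  rw [Measure.real, rayleighMeasure, withDensity_apply _ measurableSet_Ioi,
    Measure.restrict_restrict measurableSet_Ioi, Set.Ioi_inter_Ioi, sup_eq_left.2 ht,
    ← ofReal_integral_eq_lintegral_ofReal hint
      ((ae_restrict_iff' measurableSet_Ioi).2 (Eventually.of_forall hpos)), hval, zero_sub, neg_neg,
    ENNReal.toReal_ofReal (Real.exp_pos _).le]

theorem rayleighMeasure_half_Ioi_of_neg {t : ℝ} (ht : t < 0) :
    (rayleighMeasure (1 / 2)).real (Set.Ioi t) = 1 := by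
  refine le_antisymm measureReal_le_one ?_
  have h := rayleighMeasure_half_Ioi le_rfl
  rw [zero_pow two_ne_zero, mul_zero, Real.exp_zero] at h
  refine h.symm.le.trans ?_
  exact measureReal_mono (Set.Ioi_subset_Ioi ht.le)

theorem tendsto_assignmentMeasure_lt_defect {t : ℝ} (ht : 0 < t) :
    Tendsto (fun n : ℕ => (assignmentMeasure n n).real {f | t < (defect f : ℝ) / √(n : ℝ)}) atTop
      (𝓝 (Real.exp (-2 * t ^ 2))) := by
  have hm : Tendsto (fun n : ℕ => ((n : ℝ) - n) / √(n : ℝ)) atTop (𝓝 0) := by simp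
  -- The strict inequality `t√n < defect f` means `defect f ≥ ⌊t√n⌋ + 1`; the extra `1` vanishes on
  -- this scale.
  have hk : Tendsto (fun n : ℕ => ((⌊t * √(n : ℝ)⌋₊ + 1 : ℕ) : ℝ) / √(n : ℝ)) atTop (𝓝 t) := by
    have hinv : Tendsto (fun n : ℕ => (√(n : ℝ))⁻¹) atTop (𝓝 0) :=
      tendsto_inv_atTop_zero.comp tendsto_sqrt_natCast_atTop
    have := (tendsto_natFloor_mul_sqrt_div ht.le).add hinv
    rw [add_zero] at this
    refine this.congr fun n => ?_
    push_cast
    rw [add_div, one_div]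
  have h := tendsto_abelSum_div_pow (m := fun n => n) ht ht hm hk
  rw [show -2 * t * (t - 0) = -2 * t ^ 2 by ring] at h
  refine h.congr' ?_
  filter_upwards [eventually_sqrt_natCast_pos] with n hn
  rw [← assignmentMeasure_real_le_defect]
  congr 1
  ext f
  simp only [Set.mem_ofPred_eq]
  rw [lt_div_iff₀ hn, Nat.succ_le_iff, Nat.floor_lt (by positivity)]

theorem tendstoInDistribution_defect :
    TendstoInDistribution (fun (n : ℕ) (f : Fin n → Fin n) => (defect f : ℝ) / √(n : ℝ))
      atTop id (fun n => assignmentMeasure n n) (rayleighMeasure (1 / 2)) := by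
  have hmeas : ∀ n : ℕ, Measurable (fun f : Fin n → Fin n => (defect f : ℝ) / √(n : ℝ)) :=
    fun n => measurable_of_finite _
  refine ⟨fun n => (hmeas n).aemeasurable, aemeasurable_id, ?_⟩
  -- The point `0` is left out of the dense set, since the asymptotics of the sum are proved only
  -- for positive thresholds.
  refine tendsto_probabilityMeasure_of_tendsto_Ioi (dense_compl_singleton (0 : ℝ)) ?_
  intro t ht
  simp only [ProbabilityMeasure.coe_mk, Measure.map_id]
  have hmap : ∀ n : ℕ, ((assignmentMeasure n n).map
      (fun f : Fin n → Fin n => (defect f : ℝ) / √(n : ℝ))).real (Set.Ioi t) =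
      (assignmentMeasure n n).real {f | t < (defect f : ℝ) / √(n : ℝ)} := fun n =>
    map_measureReal_apply (hmeas n) measurableSet_Ioi
  simp only [hmap]
  rcases lt_or_gt_of_ne (ht : t ≠ 0) with h | h
  · rw [rayleighMeasure_half_Ioi_of_neg h]
    refine tendsto_const_nhds.congr fun n => ?_
    have : {f : Fin n → Fin n | t < (defect f : ℝ) / √(n : ℝ)} = Set.univ :=
      Set.eq_univ_of_forall fun f => h.trans_le (by positivity)
    rw [this, probReal_univ]
  · rw [rayleighMeasure_half_Ioi h.le]
    exact tendsto_assignmentMeasure_lt_defect h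

theorem mainTheorem3 :
    (∀ x y : ℝ, 0 < x →
      Tendsto (fun n : ℕ => (assignmentMeasure (numDrivers y n) n).real
          {f | ⌊x * √(n : ℝ)⌋₊ ≤ defect f})
        atTop (𝓝 (if y < x then Real.exp (-2 * x * (x - y)) else 1)) ∧
      Tendsto (fun n : ℕ => abelSum n (numDrivers y n) ⌊x * √(n : ℝ)⌋₊ /
          (n : ℝ) ^ numDrivers y n)
        atTop (𝓝 (if y < x then Real.exp (-2 * x * (x - y)) else 1))) ∧
    TendstoInDistribution (fun (n : ℕ) (f : Fin n → Fin n) => (defect f : ℝ) / √(n : ℝ))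
      atTop id (fun n => assignmentMeasure n n) (rayleighMeasure (1 / 2)) := by
  refine ⟨fun x y hx => ?_, tendstoInDistribution_defect⟩
  have h := tendsto_abelSum_numDrivers hx y
  refine ⟨?_, h⟩
  simpa only [assignmentMeasure_real_le_defect] using h
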